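/- Let $k\ge 2$. A *partially directed $k$-graph* ($k$-PDG) $\vec H$ on a vertex set $V$ of $n$ vertices is given by choosing, for each $k$-element subset of $V$, one of the following: no edge on it, an undirected edge on it, or a directed edge on it, that is, an edge together with a choice of one of its $k$ vertices, towards which the edge is said to be directed. Let $\alpha(\vec H)$ and $\beta(\vec H)$ be the number of undirected edges and the number of directed edges of $\vec H$, respectively, each divided by $\binom nk$. A $k$-PDG $\vec F$ is a *subgraph* of $\vec H$ if a $k$-PDG isomorphic to $\vec F$ can be obtained from $\vec H$ by deleting edges, deleting vertices, and forgetting the direction of edges; $\vec H$ is *$\vec F$-free* if $\vec F$ is not a subgraph of $\vec H$. For $\theta\in\mathbb R$, let $\pi(\vec F,\theta)$ be the smallest real number $p$ such that every $n$-vertex $\vec F$-free $k$-PDG $\vec H$ satisfies $\alpha(\vec H)+\theta\,\beta(\vec H)\le p+o(1)$, where $o(1)$ denotes a quantity that depends only on $n$ (for fixed $\vec F$, $\theta$) and tends to $0$ as $n\to\infty$. Let $\vec T_3$ be the $3$-PDG on vertices $1,2,3,4$ whose edges are the undirected edges $\{1,2,3\}$ and $\{1,3,4\}$ and the edge $\{1,2,4\}$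 directed towards $4$. Let $\vec T_4$ be the $4$-PDG on vertices $1,2,3,4,5$ whose edges are the undirected edges $\{1,2,3,4\}$ and $\{1,2,4,5\}$ and the edge $\{1,2,3,5\}$ directed towards $5$. **Proposition.** Let $\phi=1.909$. Then $\phi>(4\log_2 3-1)/3$ and $\pi(\vec T_3,\phi)=1$. Consequently, with $\theta=(3\phi+1)/4$, one has $\theta>\log_2 3$ and $\pi(\vec T_4,\theta)=1$. -/

import Mathlib

/-- A partially directed `k`-graph (`k`-PDG) on the vertex set `V`. Every `k`-element set of
vertices supports either no edge, or one undirected edge, or one directed edge, that is, an edge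
together with the choice of one of its vertices, towards which it is said to be directed
(or pointed). A pair `(e, v) ∈ dir` is the edge `e` directed towards `v`. -/
structure PDG (k : ℕ) (V : Type*) where
  /-- the undirected edges -/
  undir : Finset (Finset V)
  /-- the directed edges, each with its pointed vertex -/
  dir : Finset (Finset V × V)
  card_undir : ∀ e ∈ undir, e.card = k
  card_dir : ∀ p ∈ dir, p.1.card = k
  pointed_mem : ∀ p ∈ dir, p.2 ∈ p.1
  not_undir_of_dir : ∀ p ∈ dir, p.1 ∉ undir
  pointed_unique : ∀ p ∈ dir, ∀ q ∈ dir, p.1 = q.1 → p = q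

namespace PDG

/-- `α(H)`, the density of undirected edges. -/
noncomputable def alpha {k : ℕ} {V : Type*} [Fintype V] (H : PDG k V) : ℝ :=
  (H.undir.card : ℝ) / ((Fintype.card V).choose k : ℝ)

/-- `β(H)`, the density of directed edges. -/
noncomputable def beta {k : ℕ} {V : Type*} [Fintype V] (H : PDG k V) : ℝ :=
  (H.dir.card : ℝ) / ((Fintype.card V).choose k : ℝ)

/-- `F` is a subgraph of `H`: a `k`-PDG isomorphic to `F` can be obtained from `H` by deleting
edges, deleting vertices and forgetting the direction of edges. That is, the vertices of `F` embed
into those of `H` so that every directed edge of `F` goes to an edge of `H` directed towards the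
corresponding vertex, and every undirected edge of `F` goes to an edge of `H`, which may be
undirected, or directed towards any of its vertices (and then its direction is forgotten). -/
def IsSubgraph {k : ℕ} {V W : Type*} (F : PDG k V) (H : PDG k W) : Prop :=
  ∃ f : V ↪ W,
    (∀ e ∈ F.undir, e.map f ∈ H.undir ∨ ∃ w : W, (e.map f, w) ∈ H.dir) ∧
    (∀ p ∈ F.dir, (p.1.map f, f p.2) ∈ H.dir)

/-- `H` is `𝓕`-free: it contains no member of the family `𝓕` of finite `k`-PDGs as a subgraph. -/
def IsFree {k : ℕ} {W : Type*} (𝓕 : Set (Σ m : ℕ, PDG k (Fin m))) (H : PDG k W) : Prop :=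
  ∀ F ∈ 𝓕, ¬ F.2.IsSubgraph H

/-- Every `n`-vertex `𝓕`-free `k`-PDG `H` satisfies `α(H) + θ β(H) ≤ p + o(1)` as `n → ∞`,
with the `o(1)` depending on `n` only. -/
def IsTuranBound {k : ℕ} (𝓕 : Set (Σ m : ℕ, PDG k (Fin m))) (θ p : ℝ) : Prop :=
  ∀ ε : ℝ, 0 < ε → ∃ N : ℕ, ∀ n : ℕ, N ≤ n → ∀ H : PDG k (Fin n),
    H.IsFree 𝓕 → H.alpha + θ * H.beta ≤ p + ε

/-- `π(𝓕, θ) = p`: the Turán density `π(𝓕, θ)` is the smallest real number that is a Turán bound,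
and this smallest number exists and equals `p`. -/
def HasTuranDensity {k : ℕ} (𝓕 : Set (Σ m : ℕ, PDG k (Fin m))) (θ p : ℝ) : Prop :=
  IsLeast {q : ℝ | IsTuranBound 𝓕 θ q} p

/-- The partially directed `k`-triangle `T⃗ₖ`, for `k ≥ 2`, on the `k + 1` vertices `0, …, k`.
With `a = k - 2`, `b = k - 1`, `c = k` and the `k - 2` common vertices `S = {0, …, k - 3}`, it has
the undirected edges `S ∪ {a, b}` and `S ∪ {b, c}`, and the edge `S ∪ {a, c}` directed
towards `c`. Each edge is written as the set of all vertices but one. -/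
def triangle (k : ℕ) (hk : 2 ≤ k) : PDG k (Fin (k + 1)) where
  undir := {Finset.univ.erase (⟨k, by omega⟩ : Fin (k + 1)),
    Finset.univ.erase (⟨k - 2, by omega⟩ : Fin (k + 1))}
  dir := {(Finset.univ.erase (⟨k - 1, by omega⟩ : Fin (k + 1)), (⟨k, by omega⟩ : Fin (k + 1)))}
  card_undir := by
    intro e he
    simp only [Finset.mem_insert, Finset.mem_singleton] at he
    rcases he with rfl | rfl <;> simp
  card_dir := by
    intro p hp
    simp only [Finset.mem_singleton] at hp
    subst hp
    simp
  pointed_mem := by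
    intro p hp
    simp only [Finset.mem_singleton] at hp
    subst hp
    simp only [Finset.mem_erase, Finset.mem_univ, and_true, ne_eq, Fin.mk.injEq]
    omega
  not_undir_of_dir := by
    intro p hp
    simp only [Finset.mem_singleton] at hp
    subst hp
    simp only [Finset.mem_insert, Finset.mem_singleton, Finset.erase_inj _ (Finset.mem_univ _),
      Fin.mk.injEq]
    omega
  pointed_unique := by
    intro p hp q hq _
    simp only [Finset.mem_singleton] at hp hq
    rw [hp, hq]

end PDG

/-!
The lower bounds `1 ≤ π` hold because the complete undirected `k`-graph contains no directed edge,
hence no `T⃗ₖ`. What matters is the two upper bounds.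

For `T⃗₃` the upper bound is a sum-of-squares argument on four vertices. Give a triple `e` and a
vertex `y` of `e` the weight `8` if `e` is not an edge, `0` if it is undirected, `-9` if it is
directed towards `y`, and `-4` if it is directed elsewhere. For each pair `P` of vertices the square
of the sum over `y ∉ P` of the weights of `(P ∪ {y}, y)` is nonnegative. Expanding all these squares
gives a sum over 4-sets `K` of the products of the weights of two triples of `K`, up to diagonal
terms of lower order. The weights are chosen so that in a `T⃗₃`-free `K` these products, added to the
charges (`192` for an undirected edge, `367` for a directed one), total at most `768 = 4 * 192`
(`PDG.sum_charge_add_sum_weight_le`), which is a check over the `5 ^ 4` possible configurations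
(`PDG.pattern_bound_aux`). Summing over all `K` yields `α + (367 / 192) β ≤ 1 + o(1)`, and
`1.909 < 367 / 192 = 1.9114…`.

For `T⃗ₖ₊₁` the bound comes from links: in the link of `v` an edge directed towards `v` becomes
undirected and every other edge through `v` keeps its type, so the link of a `T⃗ₖ₊₁`-free graph is
`T⃗ₖ`-free (`PDG.triangle_isSubgraph_of_link`). A directed edge is counted as directed in `k` of the
links and as undirected in one, so averaging over `v` turns the parameter `φ` into
`(k φ + 1) / (k + 1)` (`PDG.IsTuranBound.triangle_succ`).
-/

open Finset

/-! ### Double counting over subsets -/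

namespace Finset

variable {V M : Type*} [Fintype V] [DecidableEq V]

theorem sum_powersetCard_succ_sum_mem [AddCommMonoid M] (k : ℕ) (f : Finset V → V → M) :
    ∑ K ∈ powersetCard (k + 1) univ, ∑ y ∈ K, f (K.erase y) y =
      ∑ e ∈ powersetCard k univ, ∑ y ∈ eᶜ, f e y := by
  rw [sum_sigma', sum_sigma']
  refine sum_bij' (fun p _ ↦ ⟨p.1.erase p.2, p.2⟩) (fun p _ ↦ ⟨insert p.2 p.1, p.2⟩)
    ?_ ?_ ?_ ?_ ?_
  · rintro ⟨K, y⟩ h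
    simp only [mem_sigma, mem_powersetCard_univ] at h
    simp [card_erase_of_mem h.2, h.1]
  · rintro ⟨e, y⟩ h
    simp only [mem_sigma, mem_powersetCard_univ, mem_compl] at h
    simp [card_insert_of_notMem h.2, h.1]
  · rintro ⟨K, y⟩ h
    simp only [mem_sigma] at h
    simp [insert_erase h.2]
  · rintro ⟨e, y⟩ h
    simp only [mem_sigma, mem_compl] at h
    simp [erase_insert h.2]
  · simp

/-- Both sides run over the ordered pairs of `(k + 1)`-sets that meet in a `k`-set `P`: on the left
through their union `K`, on the right through `P`. -/
theorem sum_powersetCard_mul_exchange [CommSemiring M] (k : ℕ) (g : Finset V → V → M) :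
    ∑ K ∈ powersetCard (k + 2) univ, ∑ y ∈ K, ∑ z ∈ K.erase y,
        g (K.erase y) z * g (K.erase z) y =
      ∑ P ∈ powersetCard k univ, ∑ z ∈ Pᶜ, ∑ y ∈ Pᶜ.erase z,
        g (insert z P) z * g (insert y P) y := by
  have h₁ := sum_powersetCard_succ_sum_mem (V := V) (k + 1)
    fun e y ↦ ∑ z ∈ e, g e z * g ((insert y e).erase z) y
  have h₂ := sum_powersetCard_succ_sum_mem (V := V) k
    fun P z ↦ ∑ y ∈ Pᶜ.erase z, g (insert z P) z * g (insert y P) y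
  rw [← h₂]
  calc
    _ = _ := sum_congr rfl fun K _ ↦ sum_congr rfl fun y hy ↦ by rw [insert_erase hy]
    _ = _ := h₁
    _ = _ := sum_congr rfl fun e _ ↦ by
      rw [sum_comm]
      refine sum_congr rfl fun z hz ↦ ?_
      rw [← compl_insert, insert_erase hz]
      refine sum_congr rfl fun y hy ↦ ?_
      have hyz : y ≠ z := fun h ↦ mem_compl.mp hy (h ▸ hz)
      rw [erase_insert_of_ne hyz]

/-- For each `k`-set `P` the off-diagonal products complete to the square of
`∑ z ∈ Pᶜ, g (insert z P) z`, so they are bounded below by minus the diagonal terms. -/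
theorem neg_le_sum_powersetCard_mul_exchange (k : ℕ) (g : Finset V → V → ℤ) (c : ℤ)
    (hg : ∀ e y, g e y ^ 2 ≤ c) (hc : 0 ≤ c) :
    -(c * (Fintype.card V * (Fintype.card V).choose k)) ≤
      ∑ K ∈ powersetCard (k + 2) univ, ∑ y ∈ K, ∑ z ∈ K.erase y,
        g (K.erase y) z * g (K.erase z) y := by
  rw [sum_powersetCard_mul_exchange]
  have key : ∀ P ∈ powersetCard k (univ : Finset V), -(c * Fintype.card V) ≤
      ∑ z ∈ Pᶜ, ∑ y ∈ Pᶜ.erase z, g (insert z P) z * g (insert y P) y := by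
    intro P _
    have hsq : ∑ z ∈ Pᶜ, ∑ y ∈ Pᶜ.erase z, g (insert z P) z * g (insert y P) y =
        (∑ z ∈ Pᶜ, g (insert z P) z) ^ 2 - ∑ z ∈ Pᶜ, g (insert z P) z ^ 2 := by
      rw [sq, sum_mul_sum, ← sum_sub_distrib]
      refine sum_congr rfl fun z hz ↦ ?_
      rw [← add_sum_erase _ _ hz]
      ring
    have hdiag : ∑ z ∈ Pᶜ, g (insert z P) z ^ 2 ≤ c * Fintype.card V := by
      calc
        _ ≤ #Pᶜ • c := sum_le_card_nsmul _ _ _ fun z _ ↦ hg _ _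
        _ = c * #Pᶜ := by rw [nsmul_eq_mul, mul_comm]
        _ ≤ _ := by gcongr; exact card_le_univ _
    rw [hsq]
    linarith [sq_nonneg (∑ z ∈ Pᶜ, g (insert z P) z)]
  calc
    _ = ∑ _P ∈ powersetCard k (univ : Finset V), -(c * (Fintype.card V : ℤ)) := by
      rw [sum_const, card_powersetCard, card_univ, nsmul_eq_mul]
      ring
    _ ≤ _ := sum_le_sum key

end Finset

/-! ### Edges and embedded triangles -/

namespace PDG

variable {k : ℕ} {V : Type*}

/-- `e` is the vertex set of an edge of `H`, undirected or directed. -/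
def IsEdge (H : PDG k V) (e : Finset V) : Prop :=
  e ∈ H.undir ∨ ∃ w, (e, w) ∈ H.dir

/-- A copy of `T⃗ₖ` given by its vertex set `univ.map f`: the vertex missing from each edge is what
matters, and the vertices `f 0, …, f (k - 3)` play symmetric roles. -/
theorem triangle_isSubgraph_iff [DecidableEq V] (hk : 2 ≤ k) (H : PDG k V) :
    (triangle k hk).IsSubgraph H ↔ ∃ f : Fin (k + 1) ↪ V,
      H.IsEdge ((univ.map f).erase (f ⟨k, by omega⟩)) ∧
      H.IsEdge ((univ.map f).erase (f ⟨k - 2, by omega⟩)) ∧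
      ((univ.map f).erase (f ⟨k - 1, by omega⟩), f ⟨k, by omega⟩) ∈ H.dir := by
  simp only [IsSubgraph, triangle, mem_insert, mem_singleton, forall_eq_or_imp, forall_eq,
    map_erase, IsEdge, and_assoc]

theorem isFree_triangle_iff {m : ℕ} {F : PDG k (Fin m)} (H : PDG k V) :
    H.IsFree {⟨m, F⟩} ↔ ¬ F.IsSubgraph H := by
  simp [IsFree]

/-! ### The inequality on four vertices -/

/-- The charge of the triple of `Fin 4` that omits `i`. A configuration on four vertices is encoded
as `S : Fin 4 → Option (Fin 4)`, where `S i` describes the triple omitting `i`: `none` means no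
edge, `some i` (the vertex outside the triple) an undirected edge, and `some h` with `h ≠ i` an edge
directed towards `h`. -/
def patternCharge (i : Fin 4) : Option (Fin 4) → ℤ
  | none => 0
  | some h => if h = i then 192 else 367

/-- The weight of the triple of `Fin 4` that omits `i`, at its vertex `j ≠ i`, in the encoding of
`patternCharge`. -/
def patternWeight (i j : Fin 4) : Option (Fin 4) → ℤ
  | none => 8
  | some h => if h = i then 0 else if h = j then -9 else -4

set_option maxRecDepth 100000 in
/-- The inequality behind the upper bound for `T⃗₃`, over all `5 ^ 4` configurations. The hypothesis
is `T⃗₃`-freeness: if the triple omitting `i` is directed towards `h`, then the triples omitting `h`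
and any third vertex `j` are not both edges. Equality holds for four undirected edges, and for two
edges directed towards the vertices that they do not share; the latter limits the charge of a
directed edge to `367`. -/
theorem pattern_bound_aux : ∀ a b c d : Option (Fin 4),
    (∀ i h j : Fin 4, i ≠ h → i ≠ j → h ≠ j →
      ![a, b, c, d] i = some h → ![a, b, c, d] h ≠ none → ![a, b, c, d] j = none) →
    ∑ i, patternCharge i (![a, b, c, d] i) + ∑ i, ∑ j ∈ univ.erase i,
      patternWeight i j (![a, b, c, d] i) * patternWeight j i (![a, b, c, d] j) ≤ 768 := by
  decide +kernel

theorem pattern_bound (S : Fin 4 → Option (Fin 4))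
    (hS : ∀ i h j, i ≠ h → i ≠ j → h ≠ j → S i = some h → S h ≠ none → S j = none) :
    ∑ i, patternCharge i (S i) + ∑ i, ∑ j ∈ univ.erase i,
      patternWeight i j (S i) * patternWeight j i (S j) ≤ 768 := by
  have h : S = ![S 0, S 1, S 2, S 3] := by
    ext1 i
    fin_cases i <;> rfl
  rw [h] at hS ⊢
  exact pattern_bound_aux _ _ _ _ hS

open Classical in
/-- The charge of a vertex set `e`: `192` for an undirected edge, `367` for a directed edge, `0` for
a non-edge. -/
noncomputable def charge (H : PDG k V) (e : Finset V) : ℤ :=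
  if e ∈ H.undir then 192 else if ∃ w, (e, w) ∈ H.dir then 367 else 0

open Classical in
/-- The weight of `e` at its vertex `y`: `0` for an undirected edge, `-9` for an edge directed
towards `y`, `-4` for an edge directed elsewhere, `8` for a non-edge. -/
noncomputable def weight (H : PDG k V) (e : Finset V) (y : V) : ℤ :=
  if e ∈ H.undir then 0 else if (e, y) ∈ H.dir then -9
  else if ∃ w, (e, w) ∈ H.dir then -4 else 8

theorem weight_sq_le (H : PDG k V) (e : Finset V) (y : V) : H.weight e y ^ 2 ≤ 81 := by
  unfold weight
  split_ifs <;> norm_num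

/-- The triple `f '' {i}ᶜ` of `H` has a code as in `patternCharge`, with matching charge and
weights. -/
theorem exists_pattern [DecidableEq V] (H : PDG 3 V) (f : Fin 4 ↪ V) (i : Fin 4) :
    ∃ s : Option (Fin 4),
      H.charge ((univ.map f).erase (f i)) = patternCharge i s ∧
      (∀ j ≠ i, H.weight ((univ.map f).erase (f i)) (f j) = patternWeight i j s) ∧
      (s ≠ none → H.IsEdge ((univ.map f).erase (f i))) ∧
      ∀ h ≠ i, s = some h → ((univ.map f).erase (f i), f h) ∈ H.dir := by
  set e := (univ.map f).erase (f i)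
  by_cases hu : e ∈ H.undir
  · refine ⟨some i, ?_, ?_, fun _ ↦ Or.inl hu, ?_⟩
    · simp [charge, patternCharge, hu]
    · simp [weight, patternWeight, hu]
    · rintro h hi hs
      exact absurd (Option.some.inj hs).symm hi
  by_cases hd : ∃ w, (e, w) ∈ H.dir
  · have ⟨w, hw⟩ := hd
    have hwe : w ∈ e := H.pointed_mem _ hw
    obtain ⟨hwi, hwf⟩ := mem_erase.mp hwe
    obtain ⟨h, -, rfl⟩ := mem_map.mp hwf
    have hi : h ≠ i := fun hh ↦ hwi (by rw [hh])
    have hiff : ∀ j, (e, f j) ∈ H.dir ↔ h = j := by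
      refine fun j ↦ ⟨fun hj ↦ f.injective ?_, fun hj ↦ hj ▸ hw⟩
      exact congrArg Prod.snd (H.pointed_unique _ hw _ hj rfl)
    refine ⟨some h, ?_, ?_, fun _ ↦ Or.inr hd, ?_⟩
    · simp [charge, patternCharge, hu, hd, hi]
    · intro j _
      simp [weight, patternWeight, hu, hd, hi, hiff]
    · rintro j - hj
      exact (hiff j).mpr (Option.some.inj hj)
  · have hd' : ∀ w, (e, w) ∉ H.dir := not_exists.mp hd
    exact ⟨none, by simp [charge, patternCharge, hu, hd'],
      by simp [weight, patternWeight, hu, hd'], by simp, by simp⟩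

theorem sum_charge_add_sum_weight_le [DecidableEq V] (H : PDG 3 V)
    (hH : ¬ (triangle 3 (by norm_num)).IsSubgraph H) (K : Finset V) (hK : K.card = 4) :
    ∑ y ∈ K, H.charge (K.erase y) +
      ∑ y ∈ K, ∑ z ∈ K.erase y, H.weight (K.erase y) z * H.weight (K.erase z) y ≤ 768 := by
  obtain ⟨f, rfl⟩ : ∃ f : Fin 4 ↪ V, univ.map f = K := by
    refine ⟨(K.equivFinOfCardEq hK).symm.toEmbedding.trans (Function.Embedding.subtype _), ?_⟩
    rw [← map_map, map_univ_equiv]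
    exact K.attach_map_val
  choose S hcharge hweight hedge hdir using H.exists_pattern f
  have hS : ∀ i h j, i ≠ h → i ≠ j → h ≠ j → S i = some h → S h ≠ none → S j = none := by
    intro i h j hih hij hhj hi hh
    by_contra hj
    -- In `T⃗₃` the directed edge omits `2` and points to `3`, and the others omit `3` and `1`.
    have hσ : ∀ i h j : Fin 4, i ≠ h → i ≠ j → h ≠ j →
        ∃ σ : Equiv.Perm (Fin 4), σ 3 = h ∧ σ 2 = i ∧ σ 1 = j := by decide +kernel
    obtain ⟨σ, h3, h2, h1⟩ := hσ i h j hih hij hhj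
    refine hH ((triangle_isSubgraph_iff _ H).mpr ⟨σ.toEmbedding.trans f, ?_⟩)
    rw [← map_map, map_univ_equiv]
    change H.IsEdge ((univ.map f).erase (f (σ 3))) ∧ H.IsEdge ((univ.map f).erase (f (σ 1))) ∧
      ((univ.map f).erase (f (σ 2)), f (σ 3)) ∈ H.dir
    rw [h1, h2, h3]
    exact ⟨hedge h hh, hedge j hj, hdir i h hih.symm hi⟩
  refine le_trans (le_of_eq ?_) (pattern_bound S hS)
  simp only [sum_map, ← map_erase]
  simp only [map_erase]
  congr 1
  · exact sum_congr rfl fun i _ ↦ hcharge i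
  · refine sum_congr rfl fun i _ ↦ sum_congr rfl fun j hj ↦ ?_
    rw [hweight i j (ne_of_mem_erase hj), hweight j i (ne_of_mem_erase hj).symm]

theorem sum_charge [Fintype V] [DecidableEq V] (H : PDG k V) :
    ∑ e ∈ powersetCard k univ, H.charge e = 192 * #H.undir + 367 * #H.dir := by
  have himg : ∀ e, (∃ w, (e, w) ∈ H.dir) ↔ e ∈ H.dir.image Prod.fst := by simp
  have hcard : #(H.dir.image Prod.fst) = #H.dir :=
    card_image_of_injOn fun p hp q hq h ↦ H.pointed_unique p hp q hq h
  have hcharge : ∀ e, H.charge e = (if e ∈ H.undir then 192 else 0) +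
      if e ∈ H.dir.image Prod.fst then 367 else 0 := by
    intro e
    by_cases hu : e ∈ H.undir
    · have : e ∉ H.dir.image Prod.fst := by
        rw [← himg]
        rintro ⟨w, hw⟩
        exact H.not_undir_of_dir _ hw hu
      simp only [charge, hu, this, if_true, if_false, add_zero]
    · simp only [charge, hu, himg, if_false, zero_add]
  have hU : H.undir ⊆ powersetCard k univ := fun e he ↦
    mem_powersetCard_univ.mpr (H.card_undir e he)
  have hD : H.dir.image Prod.fst ⊆ powersetCard k univ := fun e he ↦ by
    obtain ⟨w, hw⟩ := (himg e).mpr he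
    exact mem_powersetCard_univ.mpr (H.card_dir _ hw)
  simp only [hcharge, sum_add_distrib]
  rw [sum_ite_mem, sum_ite_mem, inter_eq_right.mpr hU, inter_eq_right.mpr hD, sum_const,
    sum_const, hcard]
  simp only [nsmul_eq_mul]
  ring

/-- The sum of the four-vertex inequality over all 4-sets. The last term is the contribution of the
diagonal of the squares and is of order `n ^ 3`, against `n ^ 4` for the others. -/
theorem card_edges_le_of_not_triangle [Fintype V] [DecidableEq V] (H : PDG 3 V)
    (hH : ¬ (triangle 3 (by norm_num)).IsSubgraph H) :
    ((Fintype.card V : ℤ) - 3) * (192 * #H.undir + 367 * #H.dir) ≤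
      768 * (Fintype.card V).choose 4 + 81 * (Fintype.card V * (Fintype.card V).choose 2) := by
  have hlocal : ∑ K ∈ powersetCard 4 (univ : Finset V), (∑ y ∈ K, H.charge (K.erase y) +
      ∑ y ∈ K, ∑ z ∈ K.erase y, H.weight (K.erase y) z * H.weight (K.erase z) y) ≤
      (Fintype.card V).choose 4 * 768 := by
    calc
      _ ≤ #(powersetCard 4 (univ : Finset V)) • (768 : ℤ) :=
        sum_le_card_nsmul _ _ _ fun K hK ↦
          H.sum_charge_add_sum_weight_le hH K (mem_powersetCard_univ.mp hK)
      _ = _ := by rw [card_powersetCard, card_univ, nsmul_eq_mul]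
  rw [sum_add_distrib] at hlocal
  have hcharge : ∑ K ∈ powersetCard 4 (univ : Finset V), ∑ y ∈ K, H.charge (K.erase y) =
      ((Fintype.card V : ℤ) - 3) * (192 * #H.undir + 367 * #H.dir) := by
    rw [sum_powersetCard_succ_sum_mem 3 fun e _ ↦ H.charge e, ← H.sum_charge, mul_sum]
    refine sum_congr rfl fun e he ↦ ?_
    rw [sum_const, nsmul_eq_mul, card_compl, mem_powersetCard_univ.mp he,
      Nat.cast_sub ((mem_powersetCard_univ.mp he).symm.trans_le (card_le_univ e))]
    rfl
  have hweight := neg_le_sum_powersetCard_mul_exchange 2 H.weight 81 H.weight_sq_le (by norm_num)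
  rw [hcharge] at hlocal
  linarith

/-! ### Turán bounds -/

theorem IsTuranBound.mono {𝓕 : Set (Σ m : ℕ, PDG k (Fin m))} {θ θ' p : ℝ}
    (h : IsTuranBound 𝓕 θ' p) (hθ : θ ≤ θ') : IsTuranBound 𝓕 θ p := by
  intro ε hε
  obtain ⟨N, hN⟩ := h ε hε
  refine ⟨N, fun n hn H hH ↦ le_trans ?_ (hN n hn H hH)⟩
  have : 0 ≤ H.beta := by unfold beta; positivity
  gcongr

theorem cast_choose_succ_mul {n : ℕ} (h : k ≤ n) :
    (n.choose (k + 1) : ℝ) * (k + 1) = n.choose k * (n - k) := by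
  rw [← Nat.cast_sub h]
  exact_mod_cast Nat.choose_succ_right_eq n k

theorem isTuranBound_triangle_three :
    IsTuranBound {⟨4, triangle 3 (by norm_num)⟩} (367 / 192) 1 := by
  intro ε hε
  refine ⟨⌈3 / ε⌉₊ + 6, fun n hn H hH ↦ ?_⟩
  have h := H.card_edges_le_of_not_triangle ((isFree_triangle_iff H).mp hH)
  rw [Fintype.card_fin] at h
  have hn6 : (6 : ℝ) ≤ n := by exact_mod_cast le_trans (Nat.le_add_left _ _) hn
  have hnε : 3 / ε ≤ (n : ℝ) - 3 := by
    have h1 : ((⌈3 / ε⌉₊ + 6 : ℕ) : ℝ) ≤ n := by exact_mod_cast hn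
    push_cast at h1
    linarith [Nat.le_ceil (3 / ε)]
  have hN : (0 : ℝ) < n.choose 3 := by
    exact_mod_cast Nat.choose_pos (by omega)
  have h4 : (n.choose 4 : ℝ) * 4 = n.choose 3 * (n - 3) := by
    convert cast_choose_succ_mul (show 3 ≤ n by omega) using 2 <;> norm_num
  have h3 : (n.choose 3 : ℝ) * 3 = n.choose 2 * (n - 2) := by
    convert cast_choose_succ_mul (show 2 ≤ n by omega) using 2 <;> norm_num
  have hR : ((n : ℝ) - 3) * (192 * #H.undir + 367 * #H.dir) ≤
      768 * n.choose 4 + 81 * (n * n.choose 2) := by exact_mod_cast h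
  have h2 : (n * n.choose 2 : ℝ) ≤ 6 * n.choose 3 := by nlinarith
  have hε3 : 3 ≤ ε * ((n : ℝ) - 3) := by
    rwa [div_le_iff₀ hε, mul_comm] at hnε
  have hsum : H.alpha + 367 / 192 * H.beta =
      (192 * #H.undir + 367 * #H.dir) / (192 * n.choose 3) := by
    unfold alpha beta
    rw [Fintype.card_fin]
    field_simp
  rw [hsum, div_le_iff₀ (by positivity)]
  have hn3 : (0 : ℝ) < n - 3 := by linarith
  refine le_of_mul_le_mul_left ?_ hn3
  nlinarith [mul_le_mul_of_nonneg_right hε3 hN.le]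

/-- The complete undirected `k`-graph. -/
def complete (k : ℕ) (V : Type*) [Fintype V] : PDG k V where
  undir := powersetCard k univ
  dir := ∅
  card_undir := fun _ he ↦ mem_powersetCard_univ.mp he
  card_dir := by simp
  pointed_mem := by simp
  not_undir_of_dir := by simp
  pointed_unique := by simp

theorem one_le_of_isTuranBound_triangle (hk : 2 ≤ k) {θ p : ℝ}
    (h : IsTuranBound {⟨k + 1, triangle k hk⟩} θ p) : 1 ≤ p := by
  refine le_of_forall_pos_le_add fun ε hε ↦ ?_
  obtain ⟨N, hN⟩ := h ε hε
  refine le_trans (le_of_eq ?_) (hN (max N k) (le_max_left _ _) (complete k _) ?_)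
  · have : ((max N k).choose k : ℝ) ≠ 0 := by
      exact_mod_cast (Nat.choose_pos (le_max_right N k)).ne'
    simp only [alpha, beta, complete, card_powersetCard, card_univ, Fintype.card_fin, card_empty,
      Nat.cast_zero, zero_div, mul_zero, add_zero]
    rw [div_self this]
  · rw [isFree_triangle_iff, triangle_isSubgraph_iff]
    rintro ⟨f, -, -, hf⟩
    exact notMem_empty _ hf

/-! ### Links -/

section Link

variable [DecidableEq V]

/-- The link of `v`: the edges of `H` through `v`, with `v` removed. An edge directed towards `v`
becomes undirected, and the others keep their type and direction. The vertex set stays `V`, so that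
`v` is an isolated vertex of its link. -/
def link (H : PDG (k + 1) V) (v : V) : PDG k V where
  undir := {e ∈ H.undir | v ∈ e}.image (·.erase v) ∪
    {p ∈ H.dir | p.2 = v}.image (·.1.erase v)
  dir := {p ∈ H.dir | v ∈ p.1.erase p.2}.image fun p ↦ (p.1.erase v, p.2)
  card_undir := by
    simp only [mem_union, mem_image, mem_filter]
    rintro _ (⟨e, ⟨he, hv⟩, rfl⟩ | ⟨p, ⟨hp, rfl⟩, rfl⟩)
    · rw [card_erase_of_mem hv, H.card_undir e he, Nat.add_sub_cancel]
    · rw [card_erase_of_mem (H.pointed_mem p hp), H.card_dir p hp, Nat.add_sub_cancel]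
  card_dir := by
    simp only [mem_image, mem_filter]
    rintro _ ⟨p, ⟨hp, hv⟩, rfl⟩
    rw [card_erase_of_mem (mem_of_mem_erase hv), H.card_dir p hp, Nat.add_sub_cancel]
  pointed_mem := by
    simp only [mem_image, mem_filter]
    rintro _ ⟨p, ⟨hp, hv⟩, rfl⟩
    exact mem_erase.mpr ⟨(ne_of_mem_erase hv).symm, H.pointed_mem p hp⟩
  not_undir_of_dir := by
    simp only [mem_image, mem_filter, mem_union]
    rintro _ ⟨p, ⟨hp, hv⟩, rfl⟩ (⟨e, ⟨he, hve⟩, h⟩ | ⟨q, ⟨hq, rfl⟩, h⟩)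
    · exact H.not_undir_of_dir p hp (erase_injOn' v hve (mem_of_mem_erase hv) h ▸ he)
    · have hqp := H.pointed_unique q hq p hp
        (erase_injOn' q.2 (H.pointed_mem q hq) (mem_of_mem_erase hv) h)
      exact ne_of_mem_erase hv (by rw [hqp])
  pointed_unique := by
    simp only [mem_image, mem_filter]
    rintro _ ⟨p, ⟨hp, hv⟩, rfl⟩ _ ⟨q, ⟨hq, hvq⟩, rfl⟩ h
    rw [H.pointed_unique p hp q hq
      (erase_injOn' v (mem_of_mem_erase hv) (mem_of_mem_erase hvq) h)]

theorem IsEdge.of_link {H : PDG (k + 1) V} {v : V} {e : Finset V} (h : (H.link v).IsEdge e) :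
    v ∉ e ∧ H.IsEdge (insert v e) := by
  simp only [IsEdge, link, mem_union, mem_image, mem_filter, Prod.mk.injEq] at h
  obtain (⟨e, ⟨he, hv⟩, rfl⟩ | ⟨p, ⟨hp, rfl⟩, rfl⟩) | ⟨w, p, ⟨hp, hv⟩, rfl, rfl⟩ := h
  · exact ⟨notMem_erase _ _, by rw [insert_erase hv]; exact Or.inl he⟩
  · exact ⟨notMem_erase _ _, by
      rw [insert_erase (H.pointed_mem p hp)]; exact Or.inr ⟨p.2, hp⟩⟩
  · exact ⟨notMem_erase _ _, by
      rw [insert_erase (mem_of_mem_erase hv)]; exact Or.inr ⟨p.2, hp⟩⟩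

theorem mem_dir_of_link {H : PDG (k + 1) V} {v w : V} {e : Finset V}
    (h : (e, w) ∈ (H.link v).dir) : (insert v e, w) ∈ H.dir := by
  simp only [link, mem_image, mem_filter, Prod.mk.injEq] at h
  obtain ⟨p, ⟨hp, hv⟩, rfl, rfl⟩ := h
  rwa [insert_erase (mem_of_mem_erase hv)]

theorem triangle_isSubgraph_of_link (hk : 2 ≤ k) {H : PDG (k + 1) V} {v : V}
    (h : (triangle k hk).IsSubgraph (H.link v)) :
    (triangle (k + 1) (by omega)).IsSubgraph H := by
  rw [triangle_isSubgraph_iff] at h ⊢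
  obtain ⟨f, h₁, h₂, h₃⟩ := h
  -- Every vertex of `T⃗ₖ` lies in one of its two undirected edges, neither of which contains `v`.
  have hv : v ∉ Set.range f := by
    rintro ⟨i, rfl⟩
    have hi₁ := h₁.of_link.1
    have hi₂ := h₂.of_link.1
    simp only [mem_erase, mem_map', mem_univ, and_true, ne_eq, not_not,
      EmbeddingLike.apply_eq_iff_eq] at hi₁ hi₂
    have := Fin.mk.inj (hi₁.symm.trans hi₂)
    omega
  let g : Fin (k + 1 + 1) ↪ V := ⟨Fin.cons v f, Fin.cons_injective_iff.mpr ⟨hv, f.injective⟩⟩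
  have hg : ∀ i : Fin (k + 1), (univ.map g).erase (g i.succ) =
      insert v ((univ.map f).erase (f i)) := by
    intro i
    have hmap : univ.map g = insert v (univ.map f) := by
      ext w
      simp only [mem_map, mem_univ, true_and, mem_insert, Fin.exists_fin_succ]
      exact or_congr_left eq_comm
    have hne : v ≠ f i := fun hvi ↦ hv ⟨i, hvi.symm⟩
    rw [hmap, show g i.succ = f i from rfl, erase_insert_of_ne hne]
  have hpos : (⟨k + 1 - 2, by omega⟩ : Fin (k + 1 + 1)) = Fin.succ ⟨k - 2, by omega⟩ := by
    ext
    simp only [Fin.val_succ]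
    omega
  have hpos' : (⟨k + 1 - 1, by omega⟩ : Fin (k + 1 + 1)) = Fin.succ ⟨k - 1, by omega⟩ := by
    ext
    simp only [Fin.val_succ]
    omega
  refine ⟨g, ?_, ?_, ?_⟩
  · exact hg ⟨k, by omega⟩ ▸ h₁.of_link.2
  · rw [hpos, hg]
    exact h₂.of_link.2
  · rw [hpos', hg]
    exact mem_dir_of_link h₃

/-- An undirected edge is counted at each of its `k + 1` vertices, a directed one only at the vertex
that it is directed towards. -/
theorem sum_card_undir_link [Fintype V] (H : PDG (k + 1) V) :
    ∑ v, #(H.link v).undir = (k + 1) * #H.undir + #H.dir := by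
  have hcard : ∀ v, #(H.link v).undir = #{e ∈ H.undir | v ∈ e} + #{p ∈ H.dir | p.2 = v} := by
    intro v
    rw [link, card_union_of_disjoint, card_image_of_injOn, card_image_of_injOn]
    · intro p hp q hq h
      obtain ⟨hpH, hpv⟩ := mem_filter.mp hp
      obtain ⟨hqH, hqv⟩ := mem_filter.mp hq
      exact H.pointed_unique p hpH q hqH
        (erase_injOn' v (hpv ▸ H.pointed_mem p hpH) (hqv ▸ H.pointed_mem q hqH) h)
    · intro e he e' he' h
      exact erase_injOn' v (mem_filter.mp he).2 (mem_filter.mp he').2 h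
    · rw [disjoint_left]
      simp only [mem_image, mem_filter]
      rintro _ ⟨e, ⟨he, hve⟩, rfl⟩ ⟨p, ⟨hp, rfl⟩, h⟩
      exact H.not_undir_of_dir p hp (erase_injOn' p.2 (H.pointed_mem p hp) hve h ▸ he)
  simp only [hcard, sum_add_distrib]
  congr 1
  · simp only [card_filter]
    rw [sum_comm, mul_comm, ← smul_eq_mul, ← sum_const]
    refine sum_congr rfl fun e he ↦ ?_
    rw [sum_boole, filter_univ_mem, H.card_undir e he, Nat.cast_id]
  · exact (card_eq_sum_card_fiberwise fun _ _ ↦ mem_coe.mpr (mem_univ _)).symm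

/-- A directed edge stays directed in the links of its `k` vertices other than the pointed one. -/
theorem sum_card_dir_link [Fintype V] (H : PDG (k + 1) V) :
    ∑ v, #(H.link v).dir = k * #H.dir := by
  have hcard : ∀ v, #(H.link v).dir = #{p ∈ H.dir | v ∈ p.1.erase p.2} := by
    intro v
    refine card_image_of_injOn fun p hp q hq h ↦ ?_
    obtain ⟨hp, hvp⟩ := mem_filter.mp hp
    obtain ⟨hq, hvq⟩ := mem_filter.mp hq
    exact H.pointed_unique p hp q hq
      (erase_injOn' v (mem_of_mem_erase hvp) (mem_of_mem_erase hvq) (Prod.mk.inj h).1)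
  simp only [hcard, card_filter]
  rw [sum_comm, mul_comm, ← smul_eq_mul, ← sum_const]
  refine sum_congr rfl fun p hp ↦ ?_
  rw [sum_boole, filter_univ_mem, card_erase_of_mem (H.pointed_mem p hp), H.card_dir p hp,
    Nat.cast_id, Nat.add_sub_cancel]

end Link

theorem IsTuranBound.triangle_succ (hk : 2 ≤ k) {φ p : ℝ}
    (h : IsTuranBound {⟨k + 1, triangle k hk⟩} φ p) :
    IsTuranBound {⟨k + 1 + 1, triangle (k + 1) (by omega)⟩} ((k * φ + 1) / (k + 1)) p := by
  intro ε hε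
  obtain ⟨N, hN⟩ := h (ε / 2) (by positivity)
  refine ⟨max N (⌈2 * k * (p + ε) / ε⌉₊ + k + 1), fun n hn H hH ↦ ?_⟩
  have hnk : k + 1 ≤ n := by
    have := le_trans (le_max_right _ _) hn
    omega
  have hlink : ∀ v, (#(H.link v).undir : ℝ) + φ * #(H.link v).dir ≤
      (p + ε / 2) * n.choose k := by
    intro v
    have hv := hN n (le_trans (le_max_left _ _) hn) (H.link v)
      ((isFree_triangle_iff _).mpr fun hT ↦
        (isFree_triangle_iff H).mp hH (triangle_isSubgraph_of_link hk hT))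
    have hc : (0 : ℝ) < n.choose k := by exact_mod_cast Nat.choose_pos (by omega)
    simp only [alpha, beta, Fintype.card_fin] at hv
    rwa [← mul_div_assoc, ← add_div, div_le_iff₀ hc] at hv
  have hsum := sum_le_sum fun v (_ : v ∈ univ) ↦ hlink v
  rw [sum_add_distrib, ← mul_sum, ← Nat.cast_sum, ← Nat.cast_sum, H.sum_card_undir_link,
    H.sum_card_dir_link, sum_const, card_univ, Fintype.card_fin, nsmul_eq_mul] at hsum
  push_cast at hsum
  have hc : (0 : ℝ) < n.choose (k + 1) := by exact_mod_cast Nat.choose_pos hnk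
  have hchoose := cast_choose_succ_mul (show k ≤ n by omega)
  have hdens : H.alpha + (k * φ + 1) / (k + 1) * H.beta =
      ((k + 1) * #H.undir + #H.dir + φ * (k * #H.dir)) / ((k + 1) * n.choose (k + 1)) := by
    simp only [alpha, beta, Fintype.card_fin]
    field_simp
    ring
  rw [hdens, div_le_iff₀ (by positivity)]
  refine hsum.trans ?_
  -- The factor `n / (n - k)` lost in passing to links is absorbed by half of `ε`.
  have hlarge : 2 * k * (p + ε) ≤ ε * n := by
    have h1 : ((⌈2 * k * (p + ε) / ε⌉₊ + k + 1 : ℕ) : ℝ) ≤ n := by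
      exact_mod_cast le_trans (le_max_right _ _) hn
    push_cast at h1
    have h2 : 2 * k * (p + ε) / ε ≤ n := by
      linarith [Nat.le_ceil (2 * k * (p + ε) / ε), (Nat.cast_nonneg k : (0 : ℝ) ≤ k)]
    rwa [div_le_iff₀ hε, mul_comm (n : ℝ)] at h2
  have hfac : n * (p + ε / 2) ≤ (p + ε) * ((n : ℝ) - k) := by linarith
  calc
    (n : ℝ) * ((p + ε / 2) * n.choose k) = n * (p + ε / 2) * n.choose k := by ring
    _ ≤ (p + ε) * ((n : ℝ) - k) * n.choose k := by gcongr
    _ = (p + ε) * ((k + 1) * n.choose (k + 1)) := by linear_combination -(p + ε) * hchoose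

/-! ### The two Turán densities -/

theorem logb_two_three_lt : Real.logb 2 3 < 5 / 3 := by
  rw [Real.logb_lt_iff_lt_rpow (by norm_num) (by norm_num)]
  refine lt_of_pow_lt_pow_left₀ 3 (by positivity) ?_
  rw [← Real.rpow_mul_natCast (by norm_num)]
  norm_num

end PDG

theorem proposition2p4 :
    PDG.HasTuranDensity {⟨4, PDG.triangle 3 (by norm_num)⟩} (1.909 : ℝ) 1 ∧
    (1.909 : ℝ) > (4 * Real.logb 2 3 - 1) / 3 ∧
    PDG.HasTuranDensity {⟨5, PDG.triangle 4 (by norm_num)⟩} ((3 * 1.909 + 1) / 4 : ℝ) 1 ∧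
    ((3 * 1.909 + 1) / 4 : ℝ) > Real.logb 2 3 := by
  have hlog := PDG.logb_two_three_lt
  have h₃ : PDG.IsTuranBound {⟨4, PDG.triangle 3 (by norm_num)⟩} (1.909 : ℝ) 1 :=
    PDG.isTuranBound_triangle_three.mono (by norm_num)
  have h₄ : PDG.IsTuranBound {⟨5, PDG.triangle 4 (by norm_num)⟩} ((3 * 1.909 + 1) / 4 : ℝ) 1 := by
    convert h₃.triangle_succ _ using 1
    norm_num
  exact ⟨⟨h₃, fun q hq ↦ PDG.one_le_of_isTuranBound_triangle _ hq⟩, by linarith,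
    ⟨h₄, fun q hq ↦ PDG.one_le_of_isTuranBound_triangle _ hq⟩, by linarith⟩
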